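/- There are absolute constants $C_1, C_2 > 0$ and $c > 1$ such that the following holds. Let $G=(V,E,w)$ be an undirected $n$-vertex graph with positive edge weights, let $k \ge 1$ be an integer and let $\epsilon \in (0,1)$ be such that $k^{\epsilon} \ge 16$. Then there is a random $(\alpha,\beta)$ hopset $H$ of $G$ with $\alpha = C_1 k^{\epsilon}$ and $\beta = c^{1/\epsilon}\, k^{1-\epsilon}$ (every outcome of $H$ is such a hopset) whose expected number of edges satisfies $$\mathbb{E}\,|H| \;\le\; C_2\left(k^{\epsilon}\, n^{1+1/k} + \frac{k^{\epsilon}}{\epsilon}\, n\right)\log \Lambda .$$ Here $\Lambda$, the aspect ratio of $G$, is the ratio between the largest and the smallest finite distance $\mathrm{dist}_G(x,y)$ between two distinct vertices of $G$ (if no two distinct vertices are connected, $\log\Lambda$ is read as $0$). A set $H$ of pairs of distinct vertices is an $(\alpha,\beta)$ hopset of $G$ if for all $u,v\in V$ $$\mathrm{dist}_G(u,v) \;\le\; \mathrm{dist}^{(\beta)}_{G'}(u,v) \;\le\; \alpha\cdot \mathrm{dist}_G(u,v),$$ where $G'=(V,E\cup H,w')$ with $w'(xy)=\mathrm{dist}_G(x,y)$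 for $xy\in H$ and $w'(e)=w(e)$ for all other edges $e$, and $\mathrm{dist}^{(\beta)}_{G'}(u,v)$ is the length of a shortest $u$-$v$ path in $G'$ with at most $\beta$ edges ($\infty$ if there is none); moreover, $H$ contains no edge $xy \in E$ with $w(xy)=\mathrm{dist}_G(x,y)$. -/

import Mathlib

open scoped ENNReal NNReal

/-- An undirected weighted graph on the vertex set `V`: a simple graph together with a
weight function on unordered pairs that is positive on the edges.  (Values of the weight
function outside the edge set are irrelevant.) -/
structure WeightedGraph (V : Type*) where
  /-- the underlying simple graph -/
  graph : SimpleGraph V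
  /-- the weight function -/
  weight : Sym2 V → ℝ≥0
  /-- edge weights are positive -/
  weight_pos : ∀ e ∈ graph.edgeSet, 0 < weight e

namespace WeightedGraph

variable {V : Type*}

/-- The length of a walk with respect to a weight function: the sum of the weights of its
edges, counted with multiplicity. -/
noncomputable def walkLength (w : Sym2 V → ℝ≥0∞) {G : SimpleGraph V} {u v : V}
    (p : G.Walk u v) : ℝ≥0∞ :=
  (p.edges.map w).sum

/-- The distance of `G`: the length of a shortest walk (`∞` if there is none). -/
noncomputable def dist (G : WeightedGraph V) (u v : V) : ℝ≥0∞ :=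
  ⨅ p : G.graph.Walk u v, walkLength (fun e => (G.weight e : ℝ≥0∞)) p

theorem walkLength_reverse (w : Sym2 V → ℝ≥0∞) {G : SimpleGraph V} {u v : V}
    (p : G.Walk u v) : walkLength w p.reverse = walkLength w p := by
  simp [walkLength, List.sum_reverse]

theorem dist_comm (G : WeightedGraph V) (u v : V) : G.dist u v = G.dist v u := by
  apply le_antisymm
  · exact le_iInf fun p => (iInf_le _ p.reverse).trans (walkLength_reverse _ p).le
  · exact le_iInf fun p => (iInf_le _ p.reverse).trans (walkLength_reverse _ p).le

/-- The distance of `G` between the two ends of an unordered pair. -/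
noncomputable def pairDist (G : WeightedGraph V) : Sym2 V → ℝ≥0∞ :=
  Sym2.lift ⟨G.dist, G.dist_comm⟩

/-- The graph `(V, E ∪ H)`. -/
def augGraph (G : WeightedGraph V) (H : Finset (Sym2 V)) : SimpleGraph V :=
  G.graph ⊔ SimpleGraph.fromEdgeSet (H : Set (Sym2 V))

open Classical in
/-- The weight function on `E ∪ H`: a hop `xy ∈ H` has weight `dist_G(x, y)`, every other edge
keeps its weight in `G`.  Since `dist_G(x, y) ≤ w(xy)` for an edge `xy` of `G`, this is the
smaller of the two weights when a hop is parallel to an edge. -/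
noncomputable def augWeight (G : WeightedGraph V) (H : Finset (Sym2 V)) (e : Sym2 V) : ℝ≥0∞ :=
  if e ∈ H then G.pairDist e else (G.weight e : ℝ≥0∞)

/-- The `β`-limited distance in `(V, E ∪ H)`: the length of a shortest walk that uses at most
`β` edges (`∞` if there is none). -/
noncomputable def hopDist (G : WeightedGraph V) (H : Finset (Sym2 V)) (β : ℝ) (u v : V) : ℝ≥0∞ :=
  ⨅ p : (G.augGraph H).Walk u v, ⨅ _ : (p.length : ℝ) ≤ β, walkLength (G.augWeight H) p

/-- `H` is an `(α, β)` hopset of `G`. -/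
structure IsHopset (G : WeightedGraph V) (α β : ℝ) (H : Finset (Sym2 V)) : Prop where
  /-- hops join distinct vertices -/
  not_isDiag : ∀ e ∈ H, ¬ e.IsDiag
  /-- no hop, with its weight, is already an edge of `G` -/
  not_edge : ∀ e ∈ H, e ∈ G.graph.edgeSet → (G.weight e : ℝ≥0∞) ≠ G.pairDist e
  /-- hops do not shorten distances -/
  le_hopDist : ∀ u v, G.dist u v ≤ G.hopDist H β u v
  /-- the stretch guarantee with at most `β` edges -/
  hopDist_le : ∀ u v, G.hopDist H β u v ≤ ENNReal.ofReal α * G.dist u v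

/-- The aspect ratio: the ratio between the largest and the smallest (finite) distance between
two distinct vertices. -/
noncomputable def aspectRatio (G : WeightedGraph V) : ℝ :=
  ((⨆ (u : V) (v : V) (_ : u ≠ v) (_ : G.graph.Reachable u v), G.dist u v) /
    (⨅ (u : V) (v : V) (_ : u ≠ v) (_ : G.graph.Reachable u v), G.dist u v)).toReal

/-- The expected number of hops of a random set of hops. -/
noncomputable def expectedSize (μ : PMF (Finset (Sym2 V))) : ℝ≥0∞ :=
  ∑' H, μ H * (H.card : ℝ≥0∞)

end WeightedGraph

/-! The hopset consists of pivot and bunch pairs in the manner of Thorup and Zwick, built in phases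
around ever sparser sets of centres.

Inside a set `S`, a chain of subsets shrinks by a factor `E` per round, and two points of `S` play
the back-and-forth game: either the pivot of one lies in the bunch of the other, giving two hops, or
the other is close to the next set (`Linked.step`, `exists_linked`). Averaging over colourings makes
each round cost at most `4 * S.card * E` bunch pairs plus one pivot pair per vertex
(`exists_sparse_subset`).

The graph invariant is `Covered`: a walk is approximated with stretch `a`, or both its ends are near
`S`. To pass to a sparser set, a walk is cut into short segments joined by single edges. If all
segments are approximated, concatenation multiplies the number of hops but keeps the stretch `a`;
one bad segment puts both ends near the new set (`Covered.step`).

As centres get sparser, `E` can grow to `X ^ g ^ j` in phase `j`, so about `1 / ε` phases suffice. A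
last chain of about `k ^ ε` rounds then ends in the empty set, leaving every walk approximated
(`exists_isHopset_nat`). The size bound is free of the aspect ratio; the logarithm matters only when
it is small, and below ratio 2 the empty hopset works (`isHopset_empty`). -/

/-! ### Random colourings, bunches and sparse subsets -/

/-- Ranking the elements of `A` by the value of `f`, the powers of `q` to the ranks sum to at most
a geometric sum. -/
theorem Finset.sum_pow_rank_le {V : Type*} {R : Type*} [LinearOrder R] [DecidableEq V] (f : V → R)
    (q : ℝ) (hq0 : 0 ≤ q) (hq1 : q ≤ 1) (A : Finset V) :
    ∑ v ∈ A, q ^ (A.filter fun w => f w ≤ f v).card ≤ ∑ j ∈ Finset.range A.card, q ^ (j + 1) := by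
  induction A using Finset.induction_on_max_value f with
  | empty => simp
  | insert a s ha hmax ih =>
    rw [Finset.sum_insert ha, Finset.card_insert_of_notMem ha, Finset.sum_range_succ, add_comm]
    refine add_le_add (le_trans (Finset.sum_le_sum fun v _ => ?_) ih) (le_of_eq ?_)
    · exact pow_le_pow_of_le_one hq0 hq1
        (Finset.card_le_card (Finset.filter_subset_filter _ (Finset.subset_insert _ _)))
    · rw [Finset.filter_true_of_mem, Finset.card_insert_of_notMem ha]
      intro w hw
      rcases Finset.mem_insert.1 hw with rfl | hw
      · exact le_rfl
      · exact hmax w hw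

/-- The number of colourings with `D` colours that avoid the colour `0` on a given set. -/
theorem card_colorings_avoiding {V : Type*} [Fintype V] [DecidableEq V] (D : ℕ) [NeZero D]
    (W : Finset V) :
    ((Finset.univ.filter fun f : V → Fin D => ∀ w ∈ W, f w ≠ 0).card : ℝ)
      = (D : ℝ) ^ Fintype.card V * (1 - 1 / (D : ℝ)) ^ W.card := by
  have hD : (D : ℝ) ≠ 0 := NeZero.ne _
  have h1 : (Finset.univ.filter fun f : V → Fin D => ∀ w ∈ W, f w ≠ 0)
      = Fintype.piFinset fun v => if v ∈ W then Finset.univ.erase (0 : Fin D) else Finset.univ := by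
    ext f
    simp only [Finset.mem_filter, Finset.mem_univ, true_and, Fintype.mem_piFinset]
    refine forall_congr' fun v => ?_
    by_cases hv : v ∈ W <;> simp [hv]
  have h2 : ∀ v, (((if v ∈ W then Finset.univ.erase (0 : Fin D) else Finset.univ).card : ℕ) : ℝ)
      = D * (if v ∈ W then (1 - 1 / (D : ℝ)) else 1) := by
    intro v
    split_ifs
    · rw [Finset.card_erase_of_mem (Finset.mem_univ _), Finset.card_univ, Fintype.card_fin,
        Nat.cast_sub (NeZero.one_le), Nat.cast_one]
      field_simp
    · simp
  rw [h1, Fintype.card_piFinset, Nat.cast_prod, Finset.prod_congr rfl fun v _ => h2 v,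
    Finset.prod_mul_distrib, Finset.prod_const, Finset.card_univ, Finset.prod_ite_mem,
    Finset.univ_inter, Finset.prod_const]

/-- The elements of `A` that are strictly closer to `u` than every element of `A'`. -/
noncomputable def bunch {V : Type*} (d : V → V → ℝ≥0∞) (A A' : Finset V) (u : V) : Finset V := by
  classical exact A.filter fun v => ∀ a ∈ A', d u v < d u a

-- An element of `A` lies in the bunch exactly when no element of `A` at most as far from `u` has
-- colour 0. For a uniform colouring this has probability `(1 - 1 / D)` to the power of its rank,
-- and the geometric series sums to at most `D`.
open Classical in
theorem sum_card_bunch_le {V : Type*} [Fintype V] (d : V → V → ℝ≥0∞) (A : Finset V) (D : ℕ)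
    [NeZero D] (u : V) :
    ∑ f : V → Fin D, ((bunch d A (A.filter fun v => f v = 0) u).card : ℝ)
      ≤ (D : ℝ) ^ Fintype.card V * D := by
  have hD : (1 : ℝ) ≤ D := by exact_mod_cast (NeZero.one_le : 1 ≤ D)
  have hD0 : (D : ℝ) ≠ 0 := NeZero.ne _
  have hq0 : (0 : ℝ) ≤ 1 - 1 / D := by
    rw [sub_nonneg, div_le_one (by linarith)]; exact hD
  have hq1 : (1 : ℝ) - 1 / D ≤ 1 := by
    have : (0 : ℝ) ≤ 1 / D := by positivity
    linarith
  have h1 : ∀ f : V → Fin D, ((bunch d A (A.filter fun v => f v = 0) u).card : ℝ)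
      = ∑ v ∈ A, if (∀ w ∈ A.filter (fun w => d u w ≤ d u v), f w ≠ 0) then (1 : ℝ) else 0 := by
    intro f
    rw [bunch, Finset.card_filter, Nat.cast_sum]
    refine Finset.sum_congr rfl fun v _ => ?_
    push_cast
    refine if_congr ?_ rfl rfl
    simp only [Finset.mem_filter, and_imp]
    constructor
    · intro h w hw hle h0
      exact absurd (h w hw h0) (not_lt.2 hle)
    · intro h a ha h0
      by_contra hlt
      exact h a ha (not_lt.1 hlt) h0
  have h2 : ∀ v, (∑ f : V → Fin D,
      if (∀ w ∈ A.filter (fun w => d u w ≤ d u v), f w ≠ 0) then (1 : ℝ) else 0)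
      = (D : ℝ) ^ Fintype.card V * (1 - 1 / (D : ℝ)) ^ (A.filter (fun w => d u w ≤ d u v)).card := by
    intro v
    rw [← card_colorings_avoiding, Finset.card_filter, Nat.cast_sum]
    push_cast
    rfl
  have h3 : ∑ j ∈ Finset.range A.card, (1 - 1 / (D : ℝ)) ^ (j + 1) ≤ D := by
    have hg := geom_sum_mul (1 - 1 / (D : ℝ)) A.card
    have hp : 0 ≤ (1 - 1 / (D : ℝ)) ^ A.card := pow_nonneg hq0 _
    simp only [pow_succ]
    rw [← Finset.sum_mul]
    have hs : ∑ j ∈ Finset.range A.card, (1 - 1 / (D : ℝ)) ^ j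
        = D * (1 - (1 - 1 / (D : ℝ)) ^ A.card) := by
      have : (∑ j ∈ Finset.range A.card, (1 - 1 / (D : ℝ)) ^ j) * (1 / D)
          = 1 - (1 - 1 / (D : ℝ)) ^ A.card := by linarith
      rw [← this]; field_simp
    rw [hs]
    have : (1 - (1 - 1 / (D : ℝ)) ^ A.card) * (1 - 1 / (D : ℝ)) ≤ 1 * 1 :=
      mul_le_mul (by linarith) hq1 hq0 zero_le_one
    calc _ = (D : ℝ) * ((1 - (1 - 1 / (D : ℝ)) ^ A.card) * (1 - 1 / (D : ℝ))) := by ring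
      _ ≤ D * (1 * 1) := by gcongr
      _ = D := by ring
  rw [Finset.sum_congr rfl fun f _ => h1 f, Finset.sum_comm, Finset.sum_congr rfl fun v _ => h2 v,
    ← Finset.mul_sum]
  exact mul_le_mul_of_nonneg_left
    ((Finset.sum_pow_rank_le (d u) _ hq0 hq1 A).trans h3) (by positivity)

theorem sum_card_color_class {V : Type*} [Fintype V] [DecidableEq V] (A : Finset V) (D : ℕ)
    [NeZero D] :
    ∑ f : V → Fin D, ((A.filter fun v => f v = 0).card : ℝ)
      = A.card * ((D : ℝ) ^ Fintype.card V * (1 / D)) := by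
  have h1 : ∀ v, (∑ f : V → Fin D, if f v = 0 then (1 : ℝ) else 0)
      = (D : ℝ) ^ Fintype.card V * (1 / D) := by
    intro v
    have h := card_colorings_avoiding (V := V) D {v}
    rw [Finset.card_filter, Nat.cast_sum] at h
    simp only [Finset.mem_singleton, forall_eq, Finset.card_singleton, pow_one] at h
    have h' : (∑ f : V → Fin D, if f v = 0 then (1 : ℝ) else 0)
        + ∑ f : V → Fin D, (((if f v ≠ 0 then 1 else 0 : ℕ)) : ℝ) = (D : ℝ) ^ Fintype.card V := by
      rw [← Finset.sum_add_distrib, Finset.sum_congr rfl (g := fun _ => (1 : ℝ))]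
      · simp
      · intro f _
        by_cases hf : f v = 0 <;> simp [hf]
    rw [h] at h'
    linarith
  simp only [Finset.card_filter, Nat.cast_sum, Nat.cast_ite, Nat.cast_one, Nat.cast_zero]
  rw [Finset.sum_comm, Finset.sum_congr rfl fun v _ => h1 v, Finset.sum_const, nsmul_eq_mul]

/-- A sparse subset `A'` of `A` for which the bunches of the vertices of `S` are small on
average.  It is found by averaging over all colourings with `2 * E` colours. -/
theorem exists_sparse_subset {V : Type*} [Fintype V] (d : V → V → ℝ≥0∞) (S A : Finset V) (E : ℕ)
    (hE : 1 ≤ E) :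
    ∃ A' ⊆ A, A'.card * E ≤ A.card ∧ ∑ u ∈ S, (bunch d A A' u).card ≤ 4 * S.card * E := by
  classical
  rcases S.eq_empty_or_nonempty with rfl | hS
  · exact ⟨∅, Finset.empty_subset _, by simp, by simp⟩
  rcases A.eq_empty_or_nonempty with rfl | hA
  · exact ⟨∅, Finset.empty_subset _, by simp, by simp [bunch]⟩
  have hE' : (0 : ℝ) < E := by exact_mod_cast hE
  have hS' : (0 : ℝ) < S.card := by exact_mod_cast hS.card_pos
  have hA' : (0 : ℝ) < A.card := by exact_mod_cast hA.card_pos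
  have : NeZero (2 * E) := ⟨by omega⟩
  set K : ℝ := ((2 * E : ℕ) : ℝ) ^ Fintype.card V with hK
  have h1 : ∑ f : V → Fin (2 * E), ((A.filter fun v => f v = 0).card : ℝ)
      = A.card * (K * (1 / (2 * E))) := by
    rw [sum_card_color_class, hK]
    push_cast
    rfl
  have h2 : ∑ f : V → Fin (2 * E), ∑ u ∈ S, ((bunch d A (A.filter fun v => f v = 0) u).card : ℝ)
      ≤ S.card * (K * (2 * E)) := by
    rw [Finset.sum_comm]
    refine (Finset.sum_le_sum fun u _ => sum_card_bunch_le d A (2 * E) u).trans ?_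
    simp [hK]
  -- With `2 * E` colours each of the two normalised quantities averages at most 1/2, so for some
  -- colouring their sum, hence each of them, is at most 1.
  obtain ⟨f, hf⟩ : ∃ f : V → Fin (2 * E),
      ((A.filter fun v => f v = 0).card : ℝ) * (E / A.card)
        + (∑ u ∈ S, ((bunch d A (A.filter fun v => f v = 0) u).card : ℝ))
          * (1 / (4 * S.card * E)) ≤ 1 := by
    by_contra! hcon
    have hlt := Finset.sum_lt_sum_of_nonempty
      (Finset.univ_nonempty (α := V → Fin (2 * E))) fun f _ => hcon f
    rw [Finset.sum_add_distrib, ← Finset.sum_mul, ← Finset.sum_mul, h1] at hlt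
    have h0 : (∑ _f : V → Fin (2 * E), (1 : ℝ)) = K := by simp [hK]
    rw [h0] at hlt
    have h3 := mul_le_mul_of_nonneg_right h2
      (show (0 : ℝ) ≤ 1 / (4 * S.card * E) by positivity)
    have h4 : (A.card : ℝ) * (K * (1 / (2 * E))) * (E / A.card) = K / 2 := by field_simp
    have h5 : (S.card : ℝ) * (K * (2 * E)) * (1 / (4 * S.card * E)) = K / 2 := by
      field_simp; norm_num
    linarith
  have ha : 0 ≤ ((A.filter fun v => f v = 0).card : ℝ) * (E / A.card) :=
    mul_nonneg (Nat.cast_nonneg _) (by positivity)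
  have hb : 0 ≤ (∑ u ∈ S, ((bunch d A (A.filter fun v => f v = 0) u).card : ℝ))
      * (1 / (4 * S.card * E)) :=
    mul_nonneg (Finset.sum_nonneg fun _ _ => Nat.cast_nonneg _) (by positivity)
  refine ⟨A.filter fun v => f v = 0, Finset.filter_subset _ _, ?_, ?_⟩
  · have : ((A.filter fun v => f v = 0).card : ℝ) * (E / A.card) ≤ 1 := by linarith
    rw [← mul_div_assoc, div_le_one hA'] at this
    exact_mod_cast this
  · have : (∑ u ∈ S, ((bunch d A (A.filter fun v => f v = 0) u).card : ℝ))
      * (1 / (4 * S.card * E)) ≤ 1 := by linarith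
    rw [mul_one_div, div_le_one (by positivity)] at this
    exact_mod_cast this

/-! ### Back-and-forth chains inside one set of centres -/

section Chain

variable {V : Type*}

/-- `u` and `v` are joined by two pairs of `H` of total length at most `L`. -/
def TwoHop (d : V → V → ℝ≥0∞) (H : Finset (Sym2 V)) (u v : V) (L : ℝ≥0∞) : Prop :=
  ∃ w, s(u, w) ∈ H ∧ s(w, v) ∈ H ∧ d u w + d w v ≤ L

/-- `H` joins every vertex to a nearest element of `A`. -/
def Pivoted (d : V → V → ℝ≥0∞) (H : Finset (Sym2 V)) (A : Finset V) : Prop :=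
  A.Nonempty → ∀ x, ∃ p ∈ A, s(x, p) ∈ H ∧ ∀ a ∈ A, d x p ≤ d x a

/-- Two points of `S` at distance at most `Δ` are joined by two pairs of `H` with stretch `2 * t`,
unless one of them is within distance `t * Δ` of `A`. -/
def Linked (d : V → V → ℝ≥0∞) (H : Finset (Sym2 V)) (S A : Finset V) (t : ℕ) : Prop :=
  ∀ u ∈ S, ∀ v ∈ S, ∀ Δ, d u v ≤ Δ → TwoHop d H u v (2 * t * Δ) ∨
    (∃ w ∈ A, d u w ≤ t * Δ) ∨ (∃ w ∈ A, d v w ≤ t * Δ)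

variable {d : V → V → ℝ≥0∞} {H H' : Finset (Sym2 V)} {S A A' : Finset V}

theorem TwoHop.symm (hd : ∀ u v, d u v = d v u) {u v : V} {L : ℝ≥0∞} (h : TwoHop d H u v L) :
    TwoHop d H v u L := by
  obtain ⟨w, h1, h2, h3⟩ := h
  refine ⟨w, by rwa [Sym2.eq_swap], by rwa [Sym2.eq_swap], ?_⟩
  rwa [hd v w, hd w u, add_comm]

theorem TwoHop.mono {u v : V} {L L' : ℝ≥0∞} (hH : H ⊆ H') (hL : L ≤ L') (h : TwoHop d H u v L) :
    TwoHop d H' u v L' := by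
  obtain ⟨w, h1, h2, h3⟩ := h
  exact ⟨w, hH h1, hH h2, h3.trans hL⟩

theorem Pivoted.mono (hH : H ⊆ H') (h : Pivoted d H A) : Pivoted d H' A := fun hA x => by
  obtain ⟨p, hp, h1, h2⟩ := h hA x
  exact ⟨p, hp, hH h1, h2⟩

theorem exists_pivoted [Fintype V] (d : V → V → ℝ≥0∞) (A : Finset V) :
    ∃ H : Finset (Sym2 V), H.card ≤ Fintype.card V ∧ Pivoted d H A := by
  classical
  rcases A.eq_empty_or_nonempty with rfl | hA
  · exact ⟨∅, by simp, fun h => absurd h (by simp)⟩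
  · choose p hp hmin using fun x => A.exists_min_image (d x) hA
    refine ⟨Finset.univ.image fun x => s(x, p x), Finset.card_image_le, fun _ x => ?_⟩
    exact ⟨p x, hp x, Finset.mem_image_of_mem (fun x => s(x, p x)) (Finset.mem_univ x), hmin x⟩

theorem exists_bunch_pairs (d : V → V → ℝ≥0∞) (S A A' : Finset V) :
    ∃ H : Finset (Sym2 V), H.card ≤ ∑ u ∈ S, (bunch d A A' u).card ∧
      ∀ u ∈ S, ∀ v ∈ bunch d A A' u, s(u, v) ∈ H := by
  classical
  refine ⟨S.biUnion fun u => (bunch d A A' u).image fun v => s(u, v), ?_, fun u hu v hv => ?_⟩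
  · exact Finset.card_biUnion_le.trans (Finset.sum_le_sum fun u _ => Finset.card_image_le)
  · exact Finset.mem_biUnion.2 ⟨u, hu, Finset.mem_image_of_mem (fun v => s(u, v)) hv⟩


/-- One back-and-forth step between a point and the pivot of another point. -/
theorem Linked.step_aux (htri : ∀ u v w, d u w ≤ d u v + d v w) (hsymm : ∀ u v, d u v = d v u)
    (hp : Pivoted d H A) (hb : ∀ u ∈ S, ∀ v ∈ bunch d A A' u, s(u, v) ∈ H) {t : ℕ} {u v : V}
    (hv : v ∈ S) {Δ : ℝ≥0∞} (hΔ : d u v ≤ Δ) (h : ∃ w ∈ A, d u w ≤ t * Δ) :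
    TwoHop d H u v (2 * (t + 1 : ℕ) * Δ) ∨ ∃ w ∈ A', d v w ≤ (t + 1 : ℕ) * Δ := by
  obtain ⟨w, hw, hle⟩ := h
  obtain ⟨p, hpA, hup, hmin⟩ := hp ⟨w, hw⟩ u
  have h1 : d u p ≤ t * Δ := (hmin w hw).trans hle
  have h2 : d v p ≤ (t + 1 : ℕ) * Δ := by
    refine (htri v u p).trans ?_
    rw [hsymm v u]
    refine (add_le_add hΔ h1).trans (le_of_eq ?_)
    push_cast; ring
  -- Either `p` is in the bunch of `v`, and `u`, `p`, `v` is a two-hop route of length at most `(2 *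
  -- t + 1) * Δ`; or some point of `A'` is at most as far from `v` as `p` is.
  by_cases hB : ∀ a ∈ A', d v p < d v a
  · left
    refine ⟨p, hup, ?_, ?_⟩
    · rw [Sym2.eq_swap]
      exact hb v hv p (by simp [bunch, hpA]; exact hB)
    · rw [hsymm p v]
      refine (add_le_add h1 h2).trans ?_
      have : ((t : ℝ≥0∞)) * Δ ≤ (t + 1 : ℕ) * Δ := by gcongr; simp
      refine (add_le_add this le_rfl).trans (le_of_eq ?_)
      ring
  · push Not at hB
    obtain ⟨a, ha, hle⟩ := hB
    exact Or.inr ⟨a, ha, hle.trans h2⟩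

/-- The end known to be near the current set switches in each round, and the radius grows by `Δ`. -/
theorem Linked.step (htri : ∀ u v w, d u w ≤ d u v + d v w) (hsymm : ∀ u v, d u v = d v u)
    (hH : H ⊆ H') (hp : Pivoted d H' A) (hb : ∀ u ∈ S, ∀ v ∈ bunch d A A' u, s(u, v) ∈ H') {t : ℕ}
    (h : Linked d H S A t) : Linked d H' S A' (t + 1) := by
  intro u hu v hv Δ hΔ
  rcases h u hu v hv Δ hΔ with h | h | h
  · exact Or.inl (h.mono hH (by gcongr; simp))
  · rcases Linked.step_aux htri hsymm hp hb hv hΔ h with h | h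
    · exact Or.inl h
    · exact Or.inr (Or.inr h)
  · rcases Linked.step_aux htri hsymm hp hb hu ((hsymm v u).trans_le hΔ) h with h | h
    · exact Or.inl (h.symm hsymm)
    · exact Or.inr (Or.inl h)

/-- A chain of `t` sparser and sparser subsets of `S`, and a set of pairs that links the points of
`S` up to the last one. -/
theorem exists_linked [Fintype V] (htri : ∀ u v w, d u w ≤ d u v + d v w)
    (hsymm : ∀ u v, d u v = d v u) (hself : ∀ u, d u u = 0) (hp : Pivoted d H S) {E : ℕ}
    (hE : 1 ≤ E) (t : ℕ) :
    ∃ (A : Finset V) (H' : Finset (Sym2 V)), H ⊆ H' ∧ A.card * E ^ t ≤ S.card ∧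
      H'.card ≤ H.card + t * (4 * S.card * E + Fintype.card V) ∧
      Pivoted d H' A ∧ Linked d H' S A t := by
  classical
  induction t with
  | zero =>
    refine ⟨S, H, subset_rfl, by simp, by simp, hp, fun u hu v hv Δ _ => ?_⟩
    exact Or.inr (Or.inl ⟨u, hu, by simp [hself]⟩)
  | succ t ih =>
    obtain ⟨A, H₁, hH, hc, hn, hp, hl⟩ := ih
    -- Bunches are averaged over all of `S`, not only over `A`, since every point of `S` must stay
    -- linked.
    obtain ⟨A', -, hA'c, hb⟩ := exists_sparse_subset d S A E hE
    obtain ⟨H₂, hc₂, hb₂⟩ := exists_bunch_pairs d S A A'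
    obtain ⟨H₃, hc₃, hp₃⟩ := exists_pivoted d A'
    refine ⟨A', H₁ ∪ (H₂ ∪ H₃), hH.trans Finset.subset_union_left, ?_, ?_, ?_, ?_⟩
    · calc A'.card * E ^ (t + 1) = A'.card * E * E ^ t := by ring
        _ ≤ A.card * E ^ t := by gcongr
        _ ≤ S.card := hc
    · calc (H₁ ∪ (H₂ ∪ H₃)).card ≤ H₁.card + (H₂.card + H₃.card) :=
          (Finset.card_union_le _ _).trans (by gcongr; exact Finset.card_union_le _ _)
        _ ≤ (H.card + t * (4 * S.card * E + Fintype.card V))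
            + (4 * S.card * E + Fintype.card V) := by
          gcongr
          exact hc₂.trans hb
        _ = _ := by ring
    · exact hp₃.mono (Finset.subset_union_right.trans Finset.subset_union_right)
    · refine hl.step htri hsymm Finset.subset_union_left (hp.mono Finset.subset_union_left) ?_
      intro u hu v hv
      exact Finset.mem_union_right _ (Finset.mem_union_left _ (hb₂ u hu v hv))

end Chain

/-! ### Hop-limited routes and pruning -/

namespace WeightedGraph

variable {V : Type*}

/-- The length of a walk of `G`. -/
noncomputable abbrev len (G : WeightedGraph V) {u v : V} (p : G.graph.Walk u v) : ℝ≥0∞ :=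
  walkLength (fun e => (G.weight e : ℝ≥0∞)) p

variable {G : WeightedGraph V} {H H' : Finset (Sym2 V)}

theorem walkLength_cons (w : Sym2 V → ℝ≥0∞) {K : SimpleGraph V} {u v x : V} (h : K.Adj u v)
    (p : K.Walk v x) : walkLength w (.cons h p) = w s(u, v) + walkLength w p := by
  simp [walkLength]

theorem walkLength_append (w : Sym2 V → ℝ≥0∞) {K : SimpleGraph V} {u v x : V} (p : K.Walk u v)
    (q : K.Walk v x) : walkLength w (p.append q) = walkLength w p + walkLength w q := by
  simp [walkLength, SimpleGraph.Walk.edges_append]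

theorem dist_le_len {u v : V} (p : G.graph.Walk u v) : G.dist u v ≤ G.len p := iInf_le _ p

theorem dist_self (G : WeightedGraph V) (u : V) : G.dist u u = 0 := by
  have h := G.dist_le_len (u := u) .nil
  simpa [len, walkLength] using h

theorem dist_triangle (G : WeightedGraph V) (u v w : V) :
    G.dist u w ≤ G.dist u v + G.dist v w := by
  simp only [dist, ENNReal.iInf_add, ENNReal.add_iInf]
  refine le_iInf fun p => le_iInf fun q => (iInf_le _ (q.append p)).trans ?_
  rw [walkLength_append]

theorem dist_le_weight {u v : V} (h : G.graph.Adj u v) : G.dist u v ≤ G.weight s(u, v) := by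
  have h := G.dist_le_len (.cons h .nil)
  simpa [len, walkLength] using h

/-- `HopReach G H n L x y`: one can get from `x` to `y` by at most `n` steps of total length at
most `L`, where a step is an edge of `G` or a pair of `H`, the latter at the cost of its distance
in `G`. -/
inductive HopReach (G : WeightedGraph V) (H : Finset (Sym2 V)) : ℕ → ℝ≥0∞ → V → V → Prop
  | refl (n : ℕ) (L : ℝ≥0∞) (x : V) : HopReach G H n L x x
  | hop {n : ℕ} {L : ℝ≥0∞} {x y z : V} (h : s(x, y) ∈ H) (hr : HopReach G H n L y z) :
      HopReach G H (n + 1) (G.dist x y + L) x z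
  | edge {n : ℕ} {L : ℝ≥0∞} {x y z : V} (h : G.graph.Adj x y) (hr : HopReach G H n L y z) :
      HopReach G H (n + 1) (G.weight s(x, y) + L) x z
  | weaken {n n' : ℕ} {L L' : ℝ≥0∞} {x y : V} (hn : n ≤ n') (hL : L ≤ L')
      (hr : HopReach G H n L x y) : HopReach G H n' L' x y

theorem HopReach.mono_set (hH : H ⊆ H') {n : ℕ} {L : ℝ≥0∞} {x y : V} (h : HopReach G H n L x y) :
    HopReach G H' n L x y := by
  induction h with
  | refl n L x => exact .refl n L x
  | hop h _ ih => exact .hop (hH h) ih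
  | edge h _ ih => exact .edge h ih
  | weaken hn hL _ ih => exact .weaken hn hL ih

theorem HopReach.trans {n m : ℕ} {L M : ℝ≥0∞} {x y z : V} (h : HopReach G H n L x y)
    (h' : HopReach G H m M y z) : HopReach G H (n + m) (L + M) x z := by
  induction h with
  | refl n L x => exact .weaken (by omega) le_add_self h'
  | hop h _ ih => exact .weaken (by omega) (by rw [add_assoc]) (.hop h (ih h'))
  | edge h _ ih => exact .weaken (by omega) (by rw [add_assoc]) (.edge h (ih h'))
  | weaken hn hL _ ih => exact .weaken (by omega) (by gcongr) (ih h')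

/-- The pairs of `H` that are not loops and not shortest edges of `G`. -/
noncomputable def prune (G : WeightedGraph V) (H : Finset (Sym2 V)) : Finset (Sym2 V) := by
  classical
  exact H.filter fun e => ¬ e.IsDiag ∧ (e ∈ G.graph.edgeSet → (G.weight e : ℝ≥0∞) ≠ G.pairDist e)

theorem mem_prune {e : Sym2 V} : e ∈ G.prune H ↔ e ∈ H ∧ ¬ e.IsDiag ∧
    (e ∈ G.graph.edgeSet → (G.weight e : ℝ≥0∞) ≠ G.pairDist e) := by
  simp [prune]

theorem pairDist_le_augWeight {x y : V} (h : (G.augGraph H).Adj x y) :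
    G.dist x y ≤ G.augWeight H s(x, y) := by
  unfold augWeight
  split_ifs with he
  · exact le_rfl
  · rcases h with h | h
    · exact dist_le_weight h
    · exact absurd (by simpa using h.1) he

theorem dist_le_walkLength_aug {x y : V} (p : (G.augGraph H).Walk x y) :
    G.dist x y ≤ walkLength (G.augWeight H) p := by
  induction p with
  | nil => rw [dist_self]; exact zero_le
  | cons h p ih =>
    rw [walkLength_cons]
    exact (G.dist_triangle _ _ _).trans (add_le_add (pairDist_le_augWeight h) ih)

theorem augWeight_le_weight {x y : V} (h : G.graph.Adj x y) :
    G.augWeight H s(x, y) ≤ G.weight s(x, y) := by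
  unfold augWeight
  split_ifs with he
  · exact dist_le_weight h
  · exact le_rfl

/-- Pruning is free: a loop is skipped, and a pruned shortest edge is traversed as an edge of `G` at
the same cost. -/
theorem HopReach.exists_walk {n : ℕ} {L : ℝ≥0∞} {x y : V} (h : HopReach G H n L x y) :
    ∃ p : (G.augGraph (G.prune H)).Walk x y, p.length ≤ n ∧
      walkLength (G.augWeight (G.prune H)) p ≤ L := by
  induction h with
  | refl n L x => exact ⟨.nil, by simp, by simp [walkLength]⟩
  | @hop n L x y z h _ ih =>
    obtain ⟨p, hn, hL⟩ := ih
    by_cases hxy : x = y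
    · subst hxy
      exact ⟨p, by omega, hL.trans le_add_self⟩
    by_cases hm : s(x, y) ∈ G.prune H
    · refine ⟨.cons (show (G.augGraph (G.prune H)).Adj x y from
        Or.inr (by simpa [hxy] using hm)) p, by simpa using hn, ?_⟩
      rw [walkLength_cons]
      refine add_le_add (le_of_eq ?_) hL
      simp [augWeight, hm, pairDist]
    · have hw : s(x, y) ∈ G.graph.edgeSet ∧ (G.weight s(x, y) : ℝ≥0∞) = G.pairDist s(x, y) := by
        simpa [mem_prune, h, hxy] using hm
      refine ⟨.cons (show (G.augGraph (G.prune H)).Adj x y from Or.inl hw.1) p,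
        by simpa using hn, ?_⟩
      rw [walkLength_cons]
      exact add_le_add ((augWeight_le_weight hw.1).trans hw.2.le) hL
  | edge h _ ih =>
    obtain ⟨p, hn, hL⟩ := ih
    refine ⟨.cons (show (G.augGraph (G.prune H)).Adj _ _ from Or.inl h) p, by simpa using hn, ?_⟩
    rw [walkLength_cons]
    exact add_le_add (augWeight_le_weight h) hL
  | weaken hn hL _ ih =>
    obtain ⟨p, hn', hL'⟩ := ih
    exact ⟨p, hn'.trans hn, hL'.trans hL⟩

theorem isHopset_prune {α β : ℝ} {a b : ℕ} (ha0 : a ≠ 0) (ha : (a : ℝ) ≤ α) (hb : (b : ℝ) ≤ β)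
    (h : ∀ (x y : V) (p : G.graph.Walk x y), HopReach G H b (a * G.len p) x y) :
    G.IsHopset α β (G.prune H) where
  not_isDiag e he := (mem_prune.1 he).2.1
  not_edge e he := (mem_prune.1 he).2.2
  le_hopDist u v := le_iInf fun p => le_iInf fun _ => dist_le_walkLength_aug p
  hopDist_le u v := by
    have h1 : (a : ℝ≥0∞) ≤ ENNReal.ofReal α := by
      rw [← ENNReal.ofReal_natCast]; exact ENNReal.ofReal_le_ofReal ha
    have h2 : (a : ℝ≥0∞) * G.dist u v ≤ ENNReal.ofReal α * G.dist u v := by gcongr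
    refine le_trans ?_ h2
    unfold dist
    rw [ENNReal.mul_iInf_of_ne (by exact_mod_cast ha0) (ENNReal.natCast_ne_top a)]
    refine le_iInf fun p => ?_
    obtain ⟨q, hq, hL⟩ := (h u v p).exists_walk
    refine (iInf_le _ q).trans ((iInf_le _ ?_).trans hL)
    exact le_trans (by exact_mod_cast hq) hb

/-! ### Cutting walks and the covering invariant -/

/-- Cutting a long walk at the first edge with which its length exceeds `δ`. -/
theorem exists_cut {x y : V} (p : G.graph.Walk x y) (δ c : ℝ≥0∞) (hc : c ≤ δ)
    (hp : δ < c + G.len p) :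
    ∃ (u v : V) (q : G.graph.Walk x u) (_ : G.graph.Adj u v) (r : G.graph.Walk v y),
      c + G.len q ≤ δ ∧ δ < c + (G.len q + G.weight s(u, v)) ∧
      G.len p = G.len q + G.weight s(u, v) + G.len r := by
  induction p generalizing c with
  | nil => simp [len, walkLength] at hp; exact absurd hc (not_le.2 hp)
  | @cons x v y h p ih =>
    rw [len, walkLength_cons] at hp
    by_cases hlt : δ < c + G.weight s(x, v)
    · refine ⟨x, v, .nil, h, p, by simpa [len, walkLength] using hc, ?_, ?_⟩
      · simpa [len, walkLength] using hlt
      · rw [len, walkLength_cons]; simp [len, walkLength]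
    · obtain ⟨u', v', q, h', r, h1, h2, h3⟩ := ih (c + G.weight s(x, v)) (not_lt.1 hlt)
        (by rwa [add_assoc])
      refine ⟨u', v', .cons h q, h', r, ?_, ?_, ?_⟩
      · rwa [len, walkLength_cons, ← add_assoc]
      · rw [len, walkLength_cons]
        simpa only [add_assoc] using h2
      · rw [len, walkLength_cons, len, walkLength_cons, ← len, h3]
        simp only [add_assoc]

/-- Splitting a walk into `N + 1` segments of length at most `δ` and single edges between them. -/
theorem hopReach_or_exists_near {A : Finset V} {T a : ℕ} (ha : 1 ≤ a) {γ : ℝ≥0∞}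
    (hQ : ∀ (x y : V) (p : G.graph.Walk x y),
      HopReach G H T (a * G.len p) x y ∨ ∃ s ∈ A, G.dist x s ≤ γ * G.len p)
    (δ : ℝ≥0∞) (N : ℕ) {x y : V} (p : G.graph.Walk x y) (hp : G.len p ≤ (N + 1 : ℕ) * δ)
    (hfin : G.len p ≠ ∞) :
    HopReach G H ((N + 1) * (T + 1)) (a * G.len p) x y ∨
      ∃ z, ∃ s ∈ A, G.dist x z ≤ G.len p ∧ G.dist y z ≤ G.len p ∧ G.dist z s ≤ γ * δ := by
  have key : ∀ {x' y' : V} (q : G.graph.Walk x' y'), G.len q ≤ δ →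
      HopReach G H T (a * G.len q) x' y' ∨ ∃ s ∈ A, G.dist x' s ≤ γ * δ := by
    intro x' y' q hq
    refine (hQ x' y' q).imp id ?_
    rintro ⟨s, hs, hle⟩
    exact ⟨s, hs, hle.trans (by gcongr)⟩
  have short : ∀ {n : ℕ}, T ≤ n → ∀ {x y : V} (p : G.graph.Walk x y), G.len p ≤ δ →
      HopReach G H n (a * G.len p) x y ∨
      ∃ z, ∃ s ∈ A, G.dist x z ≤ G.len p ∧ G.dist y z ≤ G.len p ∧ G.dist z s ≤ γ * δ := by
    intro n hn x y p hp
    refine (key p hp).imp (.weaken hn le_rfl) ?_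
    rintro ⟨s, hs, hle⟩
    refine ⟨x, s, hs, by simp [dist_self], ?_, hle⟩
    rw [dist_comm]
    exact dist_le_len p
  induction N generalizing x y with
  | zero => exact short (by omega) p (by simpa using hp)
  | succ N ih =>
    by_cases hle : G.len p ≤ δ
    · exact short (by nlinarith) p hle
    obtain ⟨u, v, q, h, r, h1, h2, h3⟩ :=
      exists_cut p δ 0 zero_le (by simpa using not_le.1 hle)
    rw [zero_add] at h1 h2
    have hqle : G.len q ≤ G.len p := by rw [h3, add_assoc]; exact le_self_add
    have hrle : G.len r ≤ G.len p := by rw [h3]; exact le_add_self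
    have hr : G.len r ≤ (N + 1 : ℕ) * δ := by
      have hδ : δ ≠ ∞ := ne_top_of_lt h2
      have : δ + G.len r ≤ δ + (N + 1 : ℕ) * δ :=
        calc δ + G.len r ≤ G.len p := by rw [h3]; gcongr
          _ ≤ _ := hp
          _ = _ := by push_cast; ring
      exact (ENNReal.add_le_add_iff_left hδ).1 this
    have huy : G.dist u y ≤ G.len p := by
      refine (dist_le_len (.cons h r)).trans ?_
      rw [len, walkLength_cons, h3, add_assoc]
      exact le_add_self
    have hxv : G.dist x v ≤ G.len q + G.weight s(u, v) :=
      (G.dist_triangle x u v).trans (add_le_add (dist_le_len q) (dist_le_weight h))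
    rcases key q h1 with hq | ⟨s, hs, hsd⟩
    · rcases ih r hr (ne_top_of_le_ne_top hfin hrle) with hr' | ⟨z, s, hs, hz1, hz2, hz3⟩
      · left
        refine .weaken ?_ ?_ (hq.trans (.edge h hr'))
        · ring_nf; omega
        · rw [h3, mul_add, mul_add, add_assoc]
          gcongr
          exact le_mul_of_one_le_left zero_le (by exact_mod_cast ha)
      · refine Or.inr ⟨z, s, hs, ?_, hz2.trans hrle, hz3⟩
        rw [h3]
        exact (G.dist_triangle x v z).trans (add_le_add hxv hz1)
    · refine Or.inr ⟨x, s, hs, by simp [dist_self], ?_, hsd⟩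
      rw [dist_comm]
      exact dist_le_len p

/-- Walks are either approximated with at most `T` steps or start and end close to `S`. -/
def Covered (G : WeightedGraph V) (H : Finset (Sym2 V)) (a : ℕ) (S : Finset V) (T : ℕ) : Prop :=
  ∀ (x y : V) (p : G.graph.Walk x y), HopReach G H T (a * G.len p) x y ∨
    ((∃ s ∈ S, G.dist x s ≤ 2 * G.len p) ∧ ∃ s ∈ S, G.dist y s ≤ 2 * G.len p)

theorem covered_univ [Fintype V] (G : WeightedGraph V) (H : Finset (Sym2 V)) (a T : ℕ) :
    Covered G H a Finset.univ T := fun x y _ =>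
  Or.inr ⟨⟨x, Finset.mem_univ x, by simp [dist_self]⟩, ⟨y, Finset.mem_univ y, by simp [dist_self]⟩⟩

/-- Walks that are not approximated yet are so by way of the pivots of their ends, unless they
start close to the next level. -/
theorem Covered.hopReach_or {a T t : ℕ} {S A : Finset V} (hc : Covered G H a S T) (hT : 4 ≤ T)
    (ha : 10 * t + 4 ≤ a) (hH : H ⊆ H') (hp : Pivoted G.dist H S) (hl : Linked G.dist H' S A t)
    (x y : V) (p : G.graph.Walk x y) :
    HopReach G H' T (a * G.len p) x y ∨ ∃ s ∈ A, G.dist x s ≤ (5 * t + 3 : ℕ) * G.len p := by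
  rcases hc x y p with h | ⟨⟨s, hs, hxs⟩, s', hs', hys⟩
  · exact Or.inl (h.mono_set hH)
  set L := G.len p
  obtain ⟨u, hu, hxu, hmin⟩ := hp ⟨s, hs⟩ x
  obtain ⟨v, hv, hyv, hmin'⟩ := hp ⟨s, hs⟩ y
  have hxu' : G.dist x u ≤ 2 * L := (hmin s hs).trans hxs
  have hyv' : G.dist y v ≤ 2 * L := (hmin' s' hs').trans hys
  have hxy : G.dist x y ≤ L := dist_le_len p
  have huv : G.dist u v ≤ 5 * L := by
    refine (G.dist_triangle u x v).trans ((add_le_add le_rfl (G.dist_triangle x y v)).trans ?_)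
    rw [dist_comm G u x]
    refine (add_le_add hxu' (add_le_add hxy hyv')).trans (le_of_eq ?_)
    ring
  rcases hl u hu v hv _ huv with ⟨w, huw, hwv, hle⟩ | ⟨w, hw, hle⟩ | ⟨w, hw, hle⟩
  · left
    -- The four hops `x`, `u`, `w`, `v`, `y` have length at most `2 + 2 * t * 5 + 2 = 10 * t + 4`
    -- times `L`.
    refine .weaken hT ?_ (.hop (hH hxu) (.hop huw (.hop hwv
      (.hop (by rw [Sym2.eq_swap]; exact hH hyv) (.refl 0 0 y)))))
    rw [dist_comm G v y, add_zero, ← add_assoc (G.dist u w)]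
    refine (add_le_add hxu' (add_le_add hle hyv')).trans ?_
    have : ((10 * t + 4 : ℕ) : ℝ≥0∞) ≤ a := by exact_mod_cast ha
    refine le_trans (le_of_eq ?_) (mul_le_mul_left this L)
    push_cast; ring
  · refine Or.inr ⟨w, hw, (G.dist_triangle x u w).trans ((add_le_add hxu' hle).trans ?_)⟩
    have : ((5 * t + 2 : ℕ) : ℝ≥0∞) ≤ (5 * t + 3 : ℕ) := by exact_mod_cast Nat.le_succ _
    refine le_trans (le_of_eq ?_) (mul_le_mul_left this L)
    push_cast; ring
  · refine Or.inr ⟨w, hw, (G.dist_triangle x y w).trans ((add_le_add hxy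
      ((G.dist_triangle y v w).trans (add_le_add hyv' hle))).trans (le_of_eq ?_))⟩
    push_cast; ring

theorem len_ne_top {x y : V} (p : G.graph.Walk x y) : G.len p ≠ ∞ := by
  induction p with
  | nil => simp [len, walkLength]
  | cons _ p ih =>
    rw [len, walkLength_cons]
    exact ENNReal.add_ne_top.2 ⟨ENNReal.coe_ne_top, ih⟩

/-- The number `5 * t + 3` of segments matches the loss factor in `Covered.hopReach_or`, so a bad
segment starts within `L` of `A`. Its start is within `L` of both ends of the walk, which restores
the constant 2. -/
theorem Covered.step {a T t : ℕ} {S A : Finset V} (hc : Covered G H a S T) (hT : 4 ≤ T)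
    (ha : 10 * t + 4 ≤ a) (hH : H ⊆ H') (hp : Pivoted G.dist H S) (hl : Linked G.dist H' S A t) :
    Covered G H' a A ((5 * t + 3) * (T + 1)) := by
  intro x y p
  set L := G.len p with hL
  have hγ : ((5 * t + 2 + 1 : ℕ) : ℝ≥0∞) * (L / (5 * t + 3 : ℕ)) = L :=
    ENNReal.mul_div_cancel (by simp) (ENNReal.natCast_ne_top _)
  rcases hopReach_or_exists_near (by omega) (hc.hopReach_or hT ha hH hp hl) (L / (5 * t + 3 : ℕ))
    (5 * t + 2) p hγ.ge (len_ne_top p) with h | ⟨z, s, hs, h1, h2, h3⟩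
  · exact Or.inl h
  · have h4 : G.dist z s ≤ L := h3.trans_eq hγ
    refine Or.inr ⟨⟨s, hs, ?_⟩, ⟨s, hs, ?_⟩⟩
    · rw [two_mul]
      exact (G.dist_triangle x z s).trans (add_le_add h1 h4)
    · rw [two_mul]
      exact (G.dist_triangle y z s).trans (add_le_add h2 h4)

/-! ### Phases and choice of parameters -/

/-- The phases: the `j`-th set of centres has size at most `n / X ^ (2 * g ^ j)`, and walks are
covered up to it with `4 * (2 * (10 * g + 3)) ^ j` hops. -/
theorem exists_covered [Fintype V] (G : WeightedGraph V) (a g X : ℕ) (hg : 2 ≤ g) (hX : 2 ≤ X)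
    (ha : 10 * (2 * g) + 4 ≤ a) (j : ℕ) :
    ∃ (S : Finset V) (H : Finset (Sym2 V)), Pivoted G.dist H S ∧
      Covered G H a S (4 * (2 * (10 * g + 3)) ^ j) ∧
      S.card ≤ Fintype.card V ∧
      S.card * X ^ (g ^ j) * 2 ^ j ≤ Fintype.card V * X ∧
      (H.card : ℝ) ≤ Fintype.card V + 2 * g * (8 * Fintype.card V * X * (1 - (1 / 2) ^ j)
        + j * Fintype.card V) := by
  induction j with
  | zero =>
    obtain ⟨H, hc, hp⟩ := exists_pivoted G.dist (Finset.univ : Finset V)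
    exact ⟨Finset.univ, H, hp, covered_univ G H a _, by simp, by simp, by simpa using hc⟩
  | succ j ih =>
    obtain ⟨S, H, hp, hc, hS, hSX, hH⟩ := ih
    obtain ⟨A, H', hsub, hA, hcard, hp', hl⟩ := exists_linked G.dist_triangle G.dist_comm
      G.dist_self hp (Nat.one_le_pow (g ^ j) X (by omega)) (2 * g)
    refine ⟨A, H', hp', ?_, ?_, ?_, ?_⟩
    · have h4 : 4 ≤ 4 * (2 * (10 * g + 3)) ^ j :=
        Nat.le_mul_of_pos_right 4 (by positivity)
      have h := hc.step h4 ha hsub hp hl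
      intro x y p
      refine (h x y p).imp (.weaken ?_ le_rfl) id
      calc (5 * (2 * g) + 3) * (4 * (2 * (10 * g + 3)) ^ j + 1)
          ≤ (5 * (2 * g) + 3) * (2 * (4 * (2 * (10 * g + 3)) ^ j)) :=
            Nat.mul_le_mul_left _ (by omega)
        _ = 4 * (2 * (10 * g + 3)) ^ (j + 1) := by ring
    · exact (Nat.le_mul_of_pos_right _ (by positivity)).trans (hA.trans hS)
    -- A chain of `2 * g` rather than `g` rounds leaves a spare factor `X ^ g ^ (j + 1)`. It pays
    -- for `2 ^ (j + 1)`, which makes the bunch costs of the phases a geometric series.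
    · have h2 : 2 ^ (j + 1) ≤ X ^ (g ^ (j + 1)) * X := by
        have : j + 1 ≤ g ^ (j + 1) + 1 := (Nat.lt_pow_self (by omega)).le.trans (Nat.le_succ _)
        calc 2 ^ (j + 1) ≤ X ^ (j + 1) := Nat.pow_le_pow_left hX _
          _ ≤ X ^ (g ^ (j + 1) + 1) := Nat.pow_le_pow_right (by omega) this
          _ = _ := by ring
      calc A.card * X ^ g ^ (j + 1) * 2 ^ (j + 1)
          ≤ A.card * X ^ g ^ (j + 1) * (X ^ (g ^ (j + 1)) * X) := by gcongr
        _ = A.card * (X ^ g ^ j) ^ (2 * g) * X := by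
          rw [← pow_mul, show g ^ j * (2 * g) = g ^ (j + 1) + g ^ (j + 1) by ring, pow_add]; ring
        _ ≤ Fintype.card V * X := by gcongr; exact hA.trans hS
    · have h1 : (H'.card : ℝ) ≤ H.card + 2 * g * (4 * S.card * X ^ g ^ j + Fintype.card V) := by
        exact_mod_cast hcard
      have h2 : (S.card : ℝ) * X ^ g ^ j ≤ Fintype.card V * X * (1 / 2) ^ j := by
        rw [one_div, inv_pow, ← div_eq_mul_inv, le_div_iff₀ (by positivity)]
        exact_mod_cast hSX
      have h3 : 2 * (g : ℝ) * (4 * (S.card * X ^ g ^ j) + Fintype.card V)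
          ≤ 2 * g * (4 * (Fintype.card V * X * (1 / 2) ^ j) + Fintype.card V) := by gcongr
      push_cast
      rw [pow_succ]
      linarith

/-- A hopset, for integer parameters. -/
theorem exists_isHopset_nat [Fintype V] (G : WeightedGraph V) (a g X t j : ℕ) (hg : 2 ≤ g)
    (hX : 2 ≤ X) (ha : 10 * (2 * g) + 4 ≤ a) (hat : 10 * t + 4 ≤ a)
    (hn : Fintype.card V < X ^ (g ^ j * t)) {α β : ℝ} (hα : (a : ℝ) ≤ α)
    (hβ : 4 * (2 * (10 * g + 3)) ^ j ≤ β) :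
    ∃ H : Finset (Sym2 V), G.IsHopset α β H ∧
      (H.card : ℝ) ≤ Fintype.card V + 8 * (2 * g + t) * (Fintype.card V * X)
        + (2 * g * j + t) * Fintype.card V := by
  obtain ⟨S, H, hp, hc, hS, hSX, hH⟩ := exists_covered G a g X hg hX ha j
  obtain ⟨A, H', hsub, hA, hcard, -, hl⟩ := exists_linked G.dist_triangle G.dist_comm
    G.dist_self hp (Nat.one_le_pow (g ^ j) X (by omega)) t
  have hA0 : A = ∅ := by
    rw [← Finset.card_eq_zero]
    by_contra h0
    rw [← pow_mul] at hA
    exact absurd ((Nat.le_mul_of_pos_left _ (Nat.pos_of_ne_zero h0)).trans (hA.trans hS))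
      (not_le.2 hn)
  have h4 : 4 ≤ 4 * (2 * (10 * g + 3)) ^ j := Nat.le_mul_of_pos_right 4 (by positivity)
  refine ⟨G.prune H', isHopset_prune (a := a) (b := 4 * (2 * (10 * g + 3)) ^ j) (by omega) hα
    (by exact_mod_cast hβ) fun x y p => ?_, ?_⟩
  · rcases hc.hopReach_or h4 hat hsub hp hl x y p with h | ⟨s, hs, -⟩
    · exact h
    · simp [hA0] at hs
  · have h0 : ((G.prune H').card : ℝ) ≤ H'.card := by
      exact_mod_cast Finset.card_le_card fun e he => (mem_prune.1 he).1
    have h1 : (H'.card : ℝ) ≤ H.card + t * (4 * S.card * X ^ g ^ j + Fintype.card V) := by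
      exact_mod_cast hcard
    have h2 : (S.card : ℝ) * X ^ g ^ j ≤ Fintype.card V * X := by
      have : S.card * X ^ g ^ j ≤ Fintype.card V * X :=
        (Nat.le_mul_of_pos_right _ (by positivity)).trans hSX
      exact_mod_cast this
    have h3 : (t : ℝ) * (4 * (S.card * X ^ g ^ j) + Fintype.card V)
        ≤ t * (4 * (Fintype.card V * X) + Fintype.card V) := by gcongr
    have h5 : 2 * (g : ℝ) * (8 * Fintype.card V * X * (1 - (1 / 2) ^ j) + j * Fintype.card V)
        ≤ 2 * g * (8 * Fintype.card V * X * 1 + j * Fintype.card V) := by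
      gcongr
      have : (0 : ℝ) ≤ (1 / 2) ^ j := by positivity
      linarith
    have h6 : (0 : ℝ) ≤ t * (Fintype.card V * X) := by positivity
    linarith

/-- A hopset whose size does not depend on the aspect ratio. -/
theorem exists_isHopset [Fintype V] (G : WeightedGraph V) (k : ℕ) (ε : ℝ) (hε0 : 0 < ε)
    (hε1 : ε < 1) (hk : 16 ≤ (k : ℝ) ^ ε) :
    ∃ H : Finset (Sym2 V),
      G.IsHopset (64 * (k : ℝ) ^ ε) (312 ^ (1 / ε) * (k : ℝ) ^ (1 - ε)) H ∧
      (H.card : ℝ) ≤ 150 * ((k : ℝ) ^ ε * (Fintype.card V : ℝ) ^ (1 + 1 / (k : ℝ))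
        + (k : ℝ) ^ ε / ε * (Fintype.card V : ℝ)) := by
  have hk1 : 1 ≤ k := by
    rcases Nat.eq_zero_or_pos k with rfl | h
    · rw [Nat.cast_zero, Real.zero_rpow hε0.ne'] at hk; norm_num at hk
    · exact h
  have hk1' : (1 : ℝ) ≤ k := by exact_mod_cast hk1
  have hk0 : (0 : ℝ) < k := by linarith
  -- the number of phases before the last one
  set m : ℕ := ⌈1 / ε⌉₊ - 1 with hm
  have hinv : 1 < 1 / ε := by rw [lt_div_iff₀ hε0]; linarith
  have hceil : 1 < ⌈1 / ε⌉₊ := by rw [Nat.lt_ceil]; simpa using hinv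
  have hm1 : 1 ≤ m := by omega
  have hm1' : (1 : ℝ) ≤ m := by exact_mod_cast hm1
  have hmc : (m : ℝ) + 1 = ⌈1 / ε⌉₊ := by
    have : m + 1 = ⌈1 / ε⌉₊ := by omega
    exact_mod_cast this
  have hmle : (m : ℝ) ≤ 1 / ε := by
    have := Nat.ceil_lt_add_one (show 0 ≤ 1 / ε by positivity)
    linarith
  have hmge : 1 / ε ≤ m + 1 := by rw [hmc]; exact Nat.le_ceil _
  have hexp : (1 - ε) / m ≤ ε := by
    rw [div_le_iff₀ (by linarith)]
    rw [div_le_iff₀ hε0] at hmge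
    linarith
  -- Chosen so that `m` phases contribute `k ^ (1 - ε)` to the exponent; the last chain supplies the
  -- remaining `k ^ ε`.
  set y : ℝ := (k : ℝ) ^ ((1 - ε) / m) with hy
  have hy1 : 1 ≤ y := Real.one_le_rpow hk1' (div_nonneg (by linarith) (by linarith))
  have hyk : y ≤ (k : ℝ) ^ ε := Real.rpow_le_rpow_of_exponent_le hk1' hexp
  have hym : y ^ m = (k : ℝ) ^ (1 - ε) := by
    rw [hy, ← Real.rpow_natCast, ← Real.rpow_mul hk0.le, div_mul_cancel₀ _ (by linarith)]
  set g : ℕ := ⌈y⌉₊ + 1 with hgdef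
  have hgy : y ≤ g := by
    rw [hgdef]; push_cast; linarith [Nat.le_ceil y]
  have hg3 : (g : ℝ) ≤ 3 * y := by
    rw [hgdef]; push_cast
    linarith [Nat.ceil_lt_add_one (show 0 ≤ y by linarith)]
  have hg2 : 2 ≤ g := by
    have : 1 ≤ ⌈y⌉₊ := Nat.one_le_ceil_iff.2 (by linarith)
    omega
  set t : ℕ := ⌈(k : ℝ) ^ ε⌉₊ with htdef
  have htk : (k : ℝ) ^ ε ≤ t := Nat.le_ceil _
  have ht2 : (t : ℝ) ≤ 2 * (k : ℝ) ^ ε := by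
    linarith [Nat.ceil_lt_add_one (show 0 ≤ (k : ℝ) ^ ε by linarith)]
  set n : ℕ := Fintype.card V with hn
  set x : ℝ := (n : ℝ) ^ (1 / (k : ℝ)) with hx
  have hx0 : 0 ≤ x := by positivity
  -- Adding 2 gives both `x < X`, hence `n < X ^ k`, and `2 ≤ X` even for `n = 0`.
  set X : ℕ := ⌊x⌋₊ + 2 with hXdef
  have hxX : x < X := by
    rw [hXdef]; push_cast; linarith [Nat.lt_floor_add_one x]
  have hX2 : (X : ℝ) ≤ x + 2 := by
    rw [hXdef]; push_cast; linarith [Nat.floor_le hx0]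
  have hxk : x ^ k = n := by
    rw [hx, ← Real.rpow_natCast, ← Real.rpow_mul (by positivity), one_div_mul_cancel hk0.ne',
      Real.rpow_one]
  have hkgt : k ≤ g ^ m * t := by
    have : (k : ℝ) ≤ g ^ m * t := by
      calc (k : ℝ) = (k : ℝ) ^ (1 - ε) * (k : ℝ) ^ ε := by
            rw [← Real.rpow_add hk0]; simp
        _ = y ^ m * (k : ℝ) ^ ε := by rw [hym]
        _ ≤ g ^ m * t := by gcongr
    exact_mod_cast this
  have hnX : n < X ^ (g ^ m * t) := by
    have h1 : (n : ℝ) < (X : ℝ) ^ k := by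
      rw [← hxk]; exact pow_lt_pow_left₀ hxX hx0 (by omega)
    have h2 : n < X ^ k := by exact_mod_cast h1
    exact h2.trans_le (Nat.pow_le_pow_right (by omega) hkgt)
  set K : ℝ := (k : ℝ) ^ ε with hK
  obtain ⟨H, hH, hcard⟩ := exists_isHopset_nat G (max (10 * (2 * g) + 4) (10 * t + 4)) g X t m hg2
    (by omega) (le_max_left _ _) (le_max_right _ _) hnX (α := 64 * K)
    (β := 312 ^ (1 / ε) * (k : ℝ) ^ (1 - ε)) (by
      rw [Nat.cast_max]
      push_cast
      exact max_le (by linarith) (by linarith)) (by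
      have h1 : 2 * (10 * (g : ℝ) + 3) ≤ 78 * y := by linarith
      have h4 : (4 : ℝ) ≤ 4 ^ m := by
        calc (4 : ℝ) = 4 ^ 1 := by norm_num
          _ ≤ 4 ^ m := pow_le_pow_right₀ (by norm_num) hm1
      -- The initial 4 hops are absorbed into `4 ^ m`, as `1 ≤ m`; this yields `312 = 4 * 78`.
      calc 4 * (2 * (10 * (g : ℝ) + 3)) ^ m ≤ 4 ^ m * (78 * y) ^ m := by gcongr
        _ = 312 ^ m * y ^ m := by rw [mul_pow, ← mul_assoc, ← mul_pow]; norm_num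
        _ ≤ 312 ^ (1 / ε) * (k : ℝ) ^ (1 - ε) := by
          rw [hym, ← Real.rpow_natCast 312 m]
          gcongr
          norm_num)
  refine ⟨H, hH, hcard.trans ?_⟩
  have hn0 : (0 : ℝ) ≤ n := Nat.cast_nonneg n
  have hpow : (n : ℝ) ^ (1 + 1 / (k : ℝ)) = n * x := by
    rw [hx, Real.rpow_add_of_nonneg hn0 zero_le_one (by positivity), Real.rpow_one]
  rw [hpow]
  have hKε : K ≤ K / ε := by rw [le_div_iff₀ hε0]; nlinarith
  have h1 : 8 * (2 * (g : ℝ) + t) * (n * X) ≤ 64 * K * (n * (x + 2)) := by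
    have : 8 * (2 * (g : ℝ) + t) ≤ 64 * K := by linarith
    gcongr
  have h2 : (2 * (g : ℝ) * m + t) * n ≤ (6 * (K / ε) + 2 * (K / ε)) * n := by
    have h3 : 2 * (g : ℝ) * m ≤ 2 * (3 * K) * (1 / ε) := by
      gcongr; linarith
    have h4 : 2 * (3 * K) * (1 / ε) = 6 * (K / ε) := by ring
    have : 2 * (g : ℝ) * m + t ≤ 6 * (K / ε) + 2 * (K / ε) := by linarith
    gcongr
  have h3 : K * n ≤ K / ε * n := by gcongr
  have h4 : (n : ℝ) ≤ K / ε * n := by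
    have : (1 : ℝ) ≤ K / ε := by linarith
    nlinarith
  have h5 : (0 : ℝ) ≤ K * (n * x) := by positivity
  have h6 : (0 : ℝ) ≤ K / ε * n := by positivity
  linarith

/-! ### Small aspect ratio -/

/-- Distinct vertices have a positive distance bounded away from zero. -/
theorem exists_pos_le_dist [Finite V] (G : WeightedGraph V) :
    ∃ δ : ℝ≥0∞, δ ≠ 0 ∧ ∀ u v, u ≠ v → δ ≤ G.dist u v := by
  obtain ⟨δ, hδ, hle⟩ : ∃ δ : ℝ≥0∞, δ ≠ 0 ∧ ∀ e ∈ G.graph.edgeSet, δ ≤ G.weight e := by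
    rcases G.graph.edgeSet.eq_empty_or_nonempty with h | h
    · exact ⟨1, one_ne_zero, by simp [h]⟩
    · obtain ⟨e, he, hmin⟩ := Set.exists_min_image _ G.weight (Set.toFinite _) h
      exact ⟨G.weight e, by exact_mod_cast (G.weight_pos e he).ne',
        fun e' he' => by exact_mod_cast hmin e' he'⟩
  refine ⟨δ, hδ, fun u v huv => le_iInf fun p => ?_⟩
  cases p with
  | nil => exact absurd rfl huv
  | cons h p =>
    rw [walkLength_cons]
    exact (hle _ h).trans le_self_add

/-- With aspect ratio less than two, no hops are needed. -/
theorem isHopset_empty [Finite V] (G : WeightedGraph V) (hΛ : G.aspectRatio < 2) {α β : ℝ}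
    (hα : 1 ≤ α) (hβ : 1 ≤ β) : G.IsHopset α β ∅ where
  not_isDiag := by simp
  not_edge := by simp
  le_hopDist u v := le_iInf fun p => le_iInf fun _ => dist_le_walkLength_aug p
  hopDist_le u v := by
    have hα' : (1 : ℝ≥0∞) ≤ ENNReal.ofReal α := by simpa using hα
    refine le_trans ?_ (le_mul_of_one_le_left zero_le hα')
    by_cases huv : u = v
    · subst huv
      refine (iInf_le _ .nil).trans ((iInf_le _ (by simp; linarith)).trans ?_)
      simp [walkLength]
    set m : ℝ≥0∞ := ⨅ (u : V) (v : V) (_ : u ≠ v) (_ : G.graph.Reachable u v), G.dist u v with hm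
    -- A walk with two or more edges has length at least `2 * m`, so a shorter one is a single edge.
    have short : ∀ q : G.graph.Walk u v, G.len q < 2 * m → G.hopDist ∅ β u v ≤ G.len q := by
      intro q hq
      obtain ⟨r, hr, hrL⟩ : ∃ p : (G.augGraph ∅).Walk u v, p.length ≤ 1 ∧
          walkLength (G.augWeight ∅) p ≤ G.len q := by
        have h : HopReach G ∅ 1 (G.len q) u v := by
          cases q with
          | nil => exact absurd rfl huv
          | cons h q =>
            cases q with
            | nil =>
              refine .weaken le_rfl ?_ (.edge h (.refl 0 0 v))
              simp [len, walkLength]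
            | cons h' q =>
              refine absurd hq (not_lt.2 ?_)
              rw [len, walkLength_cons, walkLength_cons, two_mul]
              have hle : ∀ {a b : V} (h : G.graph.Adj a b), m ≤ G.weight s(a, b) := fun h =>
                (iInf₂_le_of_le _ _ (iInf₂_le_of_le h.ne h.reachable le_rfl)).trans
                  (dist_le_weight h)
              exact add_le_add (hle h) ((hle h').trans le_self_add)
        have h' := h.exists_walk
        rwa [show G.prune ∅ = ∅ by simp [prune]] at h'
      exact (iInf_le _ r).trans ((iInf_le _
        (le_trans (by exact_mod_cast hr) hβ)).trans hrL)
    refine le_iInf fun p => ?_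
    have hlt : G.dist u v < 2 * m := by
      have hreach : G.graph.Reachable u v := ⟨p⟩
      obtain ⟨δ, hδ, hle⟩ := G.exists_pos_le_dist
      have hm0 : m ≠ 0 := fun h0 => hδ (le_zero_iff.1 (h0 ▸ le_iInf fun a => le_iInf fun b =>
        le_iInf fun hab => le_iInf fun _ => hle a b hab))
      have hmtop : m ≠ ∞ := ne_top_of_le_ne_top (len_ne_top p)
        ((iInf₂_le_of_le _ _ (iInf₂_le_of_le huv hreach le_rfl)).trans (dist_le_len p))
      set M : ℝ≥0∞ := ⨆ (u : V) (v : V) (_ : u ≠ v) (_ : G.graph.Reachable u v), G.dist u v with hM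
      have hMtop : M ≠ ∞ := by
        obtain ⟨q, ⟨r⟩, hmax⟩ := Set.exists_max_image {q : V × V | G.graph.Reachable q.1 q.2}
          (fun q => G.dist q.1 q.2) (Set.toFinite _) ⟨(u, v), hreach⟩
        refine ne_top_of_le_ne_top (ne_top_of_le_ne_top (len_ne_top r) (dist_le_len r)) ?_
        exact iSup₂_le fun a b => iSup₂_le fun _ hab => hmax (a, b) hab
      -- `toReal` sends `∞` to 0, so the bound on `aspectRatio` is informative only because `m ≠ 0`
      -- and `M ≠ ∞`.
      have hratio : M / m < 2 := by
        have h := hΛ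
        rw [aspectRatio, ← hm, ← hM] at h
        rw [← ENNReal.toReal_lt_toReal (ENNReal.div_ne_top hMtop hm0) (by simp)]
        simpa using h
      have hMlt : M < 2 * m := (ENNReal.div_lt_iff (Or.inl hm0) (Or.inl hmtop)).1 hratio
      exact lt_of_le_of_lt (le_iSup₂_of_le u v (le_iSup₂_of_le (f := fun (_ : u ≠ v)
        (_ : G.graph.Reachable u v) => G.dist u v) huv hreach le_rfl)) hMlt
    by_cases hp : G.len p < 2 * m
    · exact short p hp
    · obtain ⟨q, hq⟩ := iInf_lt_iff.1 hlt
      exact (short q hq).trans (hq.le.trans (not_lt.1 hp))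

end WeightedGraph

/-! ### The final bound -/

theorem WeightedGraph.expectedSize_pure {V : Type*} (H : Finset (Sym2 V)) :
    WeightedGraph.expectedSize (PMF.pure H) = H.card := by
  rw [expectedSize, tsum_eq_single H fun H' h => by simp [PMF.pure_apply, h]]
  simp

/-- The sampling is derandomized in `exists_sparse_subset`, so the random hopset is a single
deterministic one. -/
theorem theorem5 :
    ∃ C₁ c C₂ : ℝ, 0 < C₁ ∧ 1 < c ∧ 0 < C₂ ∧
      ∀ (V : Type*) [Fintype V] (G : WeightedGraph V) (k : ℕ) (ε : ℝ),
        0 < ε → ε < 1 → 16 ≤ (k : ℝ) ^ ε →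
        ∃ μ : PMF (Finset (Sym2 V)),
          (∀ H ∈ μ.support,
            G.IsHopset (C₁ * (k : ℝ) ^ ε) (c ^ (1 / ε) * (k : ℝ) ^ (1 - ε)) H) ∧
          WeightedGraph.expectedSize μ ≤
            ENNReal.ofReal (C₂ *
              (((k : ℝ) ^ ε * (Fintype.card V : ℝ) ^ (1 + 1 / (k : ℝ))
                + (k : ℝ) ^ ε / ε * (Fintype.card V : ℝ)) * Real.log G.aspectRatio)) := by
  refine ⟨64, 312, 300, by norm_num, by norm_num, by norm_num, ?_⟩
  intro V _ G k ε hε0 hε1 hk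
  rcases lt_or_ge G.aspectRatio 2 with hΛ | hΛ
  · refine ⟨PMF.pure ∅, fun H hH => ?_, by simp [WeightedGraph.expectedSize_pure]⟩
    obtain rfl : H = ∅ := by simpa using hH
    refine G.isHopset_empty hΛ (by linarith) ?_
    have hk1 : (1 : ℝ) ≤ k := by
      rcases Nat.eq_zero_or_pos k with rfl | h
      · rw [Nat.cast_zero, Real.zero_rpow hε0.ne'] at hk; norm_num at hk
      · exact_mod_cast h
    exact one_le_mul_of_one_le_of_one_le (Real.one_le_rpow (by norm_num) (by positivity))
      (Real.one_le_rpow hk1 (by linarith))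
  · obtain ⟨H₀, hH₀, hcard⟩ := G.exists_isHopset k ε hε0 hε1 hk
    refine ⟨PMF.pure H₀, fun H hH => ?_, ?_⟩
    · obtain rfl : H = H₀ := by simpa using hH
      exact hH₀
    · rw [WeightedGraph.expectedSize_pure, ← ENNReal.ofReal_natCast]
      refine ENNReal.ofReal_le_ofReal (hcard.trans ?_)
      -- This doubles the constant 150 of `exists_isHopset` to 300.
      have hlog : (1 : ℝ) / 2 ≤ Real.log G.aspectRatio := by
        have h1 := Real.log_two_gt_d9
        have h2 := Real.log_le_log (by norm_num) hΛ
        linarith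
      have hB : 0 ≤ (k : ℝ) ^ ε * (Fintype.card V : ℝ) ^ (1 + 1 / (k : ℝ))
          + (k : ℝ) ^ ε / ε * (Fintype.card V : ℝ) := by positivity
      nlinarith [mul_le_mul_of_nonneg_left hlog hB]
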